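/- For a semigroup $S$ with a finite generating set $A$, the word problem of $S$ with respect to $A$ is the language $$\mathrm{WP}(S,A)=\{u\#v^{\mathrm{rev}} : u,v\in A^+,\ u=_S v\}$$ over the alphabet $A\cup\{\#\}$, where $\#\notin A$, $v^{\mathrm{rev}}$ is the reverse of the word $v$, and $u=_S v$ means that $u$ and $v$ represent the same element of $S$. Say that $S$ has context-free word problem if $\mathrm{WP}(S,A)$ is a context-free language for some finite generating set $A$ of $S$. For semigroups $S$ and $T$ let $S*T$ be their semigroup free product, that is, their coproduct in the category of semigroups. Theorem. Let $S$ and $T$ be semigroups, and let $U$ be a semigroup isomorphic to $S*T$. (1) If $S$ and $T$ have context-free word problem, then so does $U$. (2) If $U$ has context-free word problem, then so do its free factors $S$ and $T$. -/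

import Mathlib

universe u v

/-- The relations identifying, in the free semigroup on the disjoint union of `S` and `T`,
a product of two letters from the same factor with the letter for their product there. -/
inductive SemigroupFreeProduct.Rel (S : Type u) (T : Type v) [Semigroup S] [Semigroup T] :
    FreeSemigroup (S ⊕ T) → FreeSemigroup (S ⊕ T) → Prop
  | inl (x y : S) : Rel S T
      (FreeSemigroup.of (Sum.inl x) * FreeSemigroup.of (Sum.inl y))
      (FreeSemigroup.of (Sum.inl (x * y)))
  | inr (x y : T) : Rel S T
      (FreeSemigroup.of (Sum.inr x) * FreeSemigroup.of (Sum.inr y))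
      (FreeSemigroup.of (Sum.inr (x * y)))

/-- The semigroup free product `S ∗ T` (the coproduct in the category of semigroups; identity
elements of `S` and `T`, if there are any, are not amalgamated). -/
abbrev SemigroupFreeProduct (S : Type u) (T : Type v) [Semigroup S] [Semigroup T] :
    Type (max u v) :=
  (conGen (SemigroupFreeProduct.Rel S T)).Quotient

/-- The word (nonempty list of letters) underlying an element of a free semigroup. -/
def FreeSemigroup.toWord {A : Type u} (w : FreeSemigroup A) : List A :=
  w.head :: w.tail

/-- The word problem `{u # vʳᵉᵛ | u, v ∈ A⁺, u =_S v}` of the semigroup `S`, where the letters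
`a : A` stand for the elements `f a` of `S`. It is a language over the alphabet `A ∪ {#}`, which
is `Option A` with `none` playing the role of the separator `#`. -/
def semigroupWordProblem {A : Type u} {S : Type v} [Semigroup S] (f : A → S) :
    Language (Option A) :=
  {w | ∃ x y : FreeSemigroup A, FreeSemigroup.lift f x = FreeSemigroup.lift f y ∧
    w = x.toWord.map some ++ [none] ++ y.toWord.reverse.map some}

/-- `S` has context-free word problem: there is a finite generating set `X` of `S` such that the
word problem of `S` with respect to `X` is a context-free language. -/
def HasContextFreeWordProblem (S : Type u) [Semigroup S] : Prop :=
  ∃ X : Set S, X.Finite ∧ Subsemigroup.closure X = ⊤ ∧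
    (semigroupWordProblem (Subtype.val : X → S)).IsContextFree

/-!
# Free products of semigroups with context-free word problem

A word over the generators of two semigroups `S` and `T` splits uniquely into maximal blocks, each
written in the generators of one factor. Multiplying every block out gives the normal form of the
element of `S ∗ T` that the word represents, so two nonempty words are equal in `S ∗ T` exactly
when they split into the same number of blocks and corresponding blocks are equal in the same
factor. That normal forms are unique is seen from the action of `S ∗ T` on lists of elements of
the factors (`SemigroupFreeProduct.action`). Hence equality of words in `S ∗ T` is the closure,
under componentwise concatenation, of the union of the equality relations of the factors
(`SemigroupFreeProduct.concatClosure_blockRel_iff`).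

Since second components are written in reverse, concatenating pairs nests their words:
`uu' # (vv')ʳᵉᵛ` arises from `u # vʳᵉᵛ` when `#` is replaced by `u' # v'ʳᵉᵛ`. So a grammar for the
union of the word problems of the factors becomes one for the word problem of `S ∗ T` when `#` is
made a nonterminal that produces either the terminal `#` or the initial symbol
(`pairLanguage_concatClosure_isContextFree`).

Conversely, the elements of `S ∗ T` outside the factor `S` form an ideal. A generating set of
`S ∗ T` therefore contains one of `S`, and the word problem of `S` is the part of the word problem
of `S ∗ T` that uses only the letters from `S`. Such a part of a context-free language is
context-free: the rules that mention other letters are dropped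
(`HasContextFreeWordProblem.of_mulHom`). The same argument, applied to isomorphisms, shows that
the choice of `U` up to isomorphism is immaterial.
-/

/-! ### Grammars and substitutions -/

namespace ContextFreeGrammar

section Substitution

variable {T T' T'' N N' N'' : Type*}

/-- Replace each terminal `t` by the symbol `τ t` and each nonterminal `n` by `φ n`. -/
def substSymbol (τ : T → Symbol T' N') (φ : N → N') : Symbol T N → Symbol T' N'
  | .terminal t => τ t
  | .nonterminal n => .nonterminal (φ n)

/-- The rule obtained from `r` by substituting symbols on both sides. -/
def substRule (τ : T → Symbol T' N') (φ : N → N') (r : ContextFreeRule T N) :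
    ContextFreeRule T' N' :=
  ⟨φ r.input, r.output.map (substSymbol τ φ)⟩

/-- Derivations are preserved by a substitution of symbols that carries rules to rules. -/
theorem Derives.subst {g : ContextFreeGrammar T} {g' : ContextFreeGrammar T'}
    {τ : T → Symbol T' g'.NT} {φ : g.NT → g'.NT}
    (h : ∀ r ∈ g.rules, substRule τ φ r ∈ g'.rules) {u v : List (Symbol T g.NT)}
    (huv : g.Derives u v) :
    g'.Derives (u.map (substSymbol τ φ)) (v.map (substSymbol τ φ)) := by
  induction huv with
  | refl => rfl
  | tail _ hp ih =>
    refine ih.trans_produces ?_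
    obtain ⟨r, hr, hrw⟩ := hp
    obtain ⟨p, q, rfl, rfl⟩ := hrw.exists_parts
    refine ⟨_, h r hr, ?_⟩
    simpa [substRule, substSymbol] using (substRule τ φ r).rewrites_of_exists_parts
      (p.map (substSymbol τ φ)) (q.map (substSymbol τ φ))

/-- The language denoted by a symbol, given the languages denoted by terminals and by
nonterminals. -/
def symbolLanguage (σ : T → Language T') (I : N → Language T') : Symbol T N → Language T'
  | .terminal t => σ t
  | .nonterminal n => I n

theorem symbolLanguage_substSymbol (σ : T' → Language T'') (I : N' → Language T'')
    (τ : T → Symbol T' N') (φ : N → N') (s : Symbol T N) :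
    symbolLanguage σ I (substSymbol τ φ s) =
      symbolLanguage (fun t => symbolLanguage σ I (τ t)) (I ∘ φ) s := by
  cases s <;> rfl

theorem prod_map_singleton (w : List T) (f : T → T') :
    (w.map fun t => ({[f t]} : Language T')).prod = {w.map f} := by
  induction w with
  | nil => rfl
  | cons a w ih =>
    rw [List.map_cons, List.prod_cons, ih]
    exact Set.image2_singleton.trans rfl

/-- Soundness of a grammar for an interpretation of its nonterminals: if the interpretation `I`
is closed under all rules, then it contains every derivable word. -/
theorem Derives.mem_prod_symbolLanguage {g : ContextFreeGrammar T} {I : g.NT → Language T}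
    (h : ∀ r ∈ g.rules,
      (r.output.map (symbolLanguage (fun t => {[t]}) I)).prod ≤ I r.input)
    {u : List (Symbol T g.NT)} {w : List T} (huw : g.Derives u (w.map .terminal)) :
    w ∈ (u.map (symbolLanguage (fun t => {[t]}) I)).prod := by
  induction huw using Relation.ReflTransGen.head_induction_on with
  | refl =>
    rw [List.map_map]
    have := prod_map_singleton w id
    rw [List.map_id] at this
    exact this.ge rfl
  | head hp _ ih =>
    obtain ⟨r, hr, hrw⟩ := hp
    obtain ⟨p, q, rfl, rfl⟩ := hrw.exists_parts
    simp only [List.map_append, List.prod_append, List.map_cons, List.map_nil,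
      List.prod_singleton] at ih ⊢
    exact mul_le_mul' (mul_le_mul' le_rfl (h r hr)) le_rfl ih

/-- The words obtained from words derivable from the nonterminal `n` by replacing each letter `t`
by a word of `σ t`. -/
def substLanguage (g : ContextFreeGrammar T) (σ : T → Language T') (n : g.NT) : Language T' :=
  {w | ∃ v : List T, g.Derives [.nonterminal n] (v.map .terminal) ∧ w ∈ (v.map σ).prod}

/-- Derivations from the single symbols of a string combine to a derivation from the string. -/
theorem exists_derives_of_mem_prod (g : ContextFreeGrammar T) (σ : T → Language T')
    (u : List (Symbol T g.NT)) (w : List T')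
    (hw : w ∈ (u.map (symbolLanguage σ (g.substLanguage σ))).prod) :
    ∃ v : List T, g.Derives u (v.map .terminal) ∧ w ∈ (v.map σ).prod := by
  induction u generalizing w with
  | nil => exact ⟨[], .refl _, hw⟩
  | cons s u ih =>
    rw [List.map_cons, List.prod_cons] at hw
    obtain ⟨a, ha, b, hb, rfl⟩ := Language.mem_mul.1 hw
    obtain ⟨v, hv, hbv⟩ := ih b hb
    obtain ⟨v', hv', hav⟩ :
        ∃ v' : List T, g.Derives [s] (v'.map .terminal) ∧ a ∈ (v'.map σ).prod := by
      cases s with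
      | terminal t => exact ⟨[t], .refl _, by simpa [symbolLanguage] using ha⟩
      | nonterminal n => exact ha
    refine ⟨v' ++ v, ?_, ?_⟩
    · rw [List.map_append]
      exact (hv'.append_right u).trans (hv.append_left _)
    · rw [List.map_append, List.prod_append]
      exact Language.append_mem_mul hav hbv

theorem prod_output_le_substLanguage (g : ContextFreeGrammar T) (σ : T → Language T')
    {r : ContextFreeRule T g.NT} (hr : r ∈ g.rules) :
    (r.output.map (symbolLanguage σ (g.substLanguage σ))).prod ≤ g.substLanguage σ r.input := by
  intro w hw
  obtain ⟨v, hv, hwv⟩ := g.exists_derives_of_mem_prod σ _ w hw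
  exact ⟨v, Produces.trans_derives ⟨r, hr, .input_output⟩ hv, hwv⟩

/-- A substituted rule is sound for an interpretation that restricts to `substLanguage`. With
`Derives.mem_prod_symbolLanguage` this bounds the language of a grammar built from copies of the
rules of other grammars. -/
theorem prod_output_substRule_le {g : ContextFreeGrammar T} {σ : T → Language T'}
    {I : N' → Language T'} {τ : T → Symbol T' N'} {φ : g.NT → N'}
    (hσ : ∀ t, symbolLanguage (fun t => {[t]}) I (τ t) = σ t)
    (hI : ∀ n, I (φ n) = g.substLanguage σ n)
    {r : ContextFreeRule T g.NT} (hr : r ∈ g.rules) :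
    ((substRule τ φ r).output.map (symbolLanguage (fun t => {[t]}) I)).prod ≤
      I (substRule τ φ r).input := by
  have hI' : I ∘ φ = g.substLanguage σ := funext hI
  have : symbolLanguage (fun t => {[t]}) I ∘ substSymbol τ φ =
      symbolLanguage σ (g.substLanguage σ) := by
    funext s
    rw [Function.comp_apply, symbolLanguage_substSymbol, hI', funext hσ]
  simp only [substRule, List.map_map, this, hI]
  exact g.prod_output_le_substLanguage σ hr

end Substitution

end ContextFreeGrammar

/-! ### Closure properties of context-free languages -/

namespace Language.IsContextFree

open ContextFreeGrammar

variable {T T' : Type*}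

protected theorem map {L : Language T} (hL : L.IsContextFree) (f : T → T') :
    (Language.map f L).IsContextFree := by
  classical
  obtain ⟨g, rfl⟩ := hL
  let τ : T → Symbol T' g.NT := fun t => .terminal (f t)
  let g' : ContextFreeGrammar T' := ⟨g.NT, g.initial, g.rules.image (substRule τ id)⟩
  refine ⟨g', Set.Subset.antisymm (fun w hw => ?_) ?_⟩
  · have key := Derives.mem_prod_symbolLanguage (g := g')
      (I := g.substLanguage fun t => {[f t]}) (fun r hr => by
        obtain ⟨r', hr', rfl⟩ := Finset.mem_image.1 hr
        exact prod_output_substRule_le (g := g) (σ := fun t => {[f t]}) (fun _ => rfl)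
          (fun _ => rfl) hr') hw
    rw [List.map_singleton, List.prod_singleton] at key
    obtain ⟨v, hv, hw⟩ := key
    rw [prod_map_singleton] at hw
    exact ⟨v, hv, hw.symm⟩
  · rintro _ ⟨v, hv, rfl⟩
    have := Derives.subst (g' := g') (τ := τ) (φ := id)
      (fun r hr => Finset.mem_image_of_mem _ hr) hv
    change g'.Derives [.nonterminal g.initial] _
    simpa [τ, substSymbol, Function.comp_def] using this

protected theorem add {L₁ L₂ : Language T} (h₁ : L₁.IsContextFree) (h₂ : L₂.IsContextFree) :
    (L₁ + L₂).IsContextFree := by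
  classical
  obtain ⟨g₁, rfl⟩ := h₁
  obtain ⟨g₂, rfl⟩ := h₂
  let φ₁ : g₁.NT → Option (g₁.NT ⊕ g₂.NT) := fun n => some (.inl n)
  let φ₂ : g₂.NT → Option (g₁.NT ⊕ g₂.NT) := fun n => some (.inr n)
  let g : ContextFreeGrammar T := ⟨Option (g₁.NT ⊕ g₂.NT), none,
    {⟨none, [.nonterminal (φ₁ g₁.initial)]⟩, ⟨none, [.nonterminal (φ₂ g₂.initial)]⟩} ∪
      (g₁.rules.image (substRule .terminal φ₁) ∪ g₂.rules.image (substRule .terminal φ₂))⟩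
  let σ : T → Language T := fun t => {[t]}
  let I : Option (g₁.NT ⊕ g₂.NT) → Language T := fun n => n.elim
    (g₁.substLanguage σ g₁.initial + g₂.substLanguage σ g₂.initial)
    (Sum.elim (g₁.substLanguage σ) (g₂.substLanguage σ))
  have hsub (g : ContextFreeGrammar T) : g.substLanguage σ g.initial ≤ g.language := by
    rintro w ⟨v, hv, hw⟩
    have := prod_map_singleton v id
    rw [List.map_id] at this
    obtain rfl : w = v := this.le hw
    exact hv
  refine ⟨g, Set.Subset.antisymm (fun w hw => ?_) ?_⟩
  · have key := Derives.mem_prod_symbolLanguage (g := g) (I := I) (fun r hr => by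
        simp only [g, Finset.mem_union, Finset.mem_insert, Finset.mem_singleton,
          Finset.mem_image] at hr
        rcases hr with (rfl | rfl) | ⟨r, hr, rfl⟩ | ⟨r, hr, rfl⟩
        · simp [symbolLanguage, I, φ₁]
        · simp [symbolLanguage, I, φ₂]
        · exact prod_output_substRule_le (I := I) (σ := σ) (fun _ => rfl) (fun _ => rfl) hr
        · exact prod_output_substRule_le (I := I) (σ := σ) (fun _ => rfl) (fun _ => rfl) hr) hw
    rw [List.map_singleton, List.prod_singleton] at key
    exact key.imp (fun h => hsub g₁ h) (fun h => hsub g₂ h)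
  · rintro w (hw | hw)
    · have := Derives.subst (g' := g) (τ := .terminal) (φ := φ₁) (fun r hr =>
        Finset.mem_union_right _ (Finset.mem_union_left _ (Finset.mem_image_of_mem _ hr))) hw
      refine Produces.trans_derives
        ⟨⟨none, [.nonterminal (φ₁ g₁.initial)]⟩, by simp [g], .input_output⟩ ?_
      simpa [substSymbol, Function.comp_def] using this
    · have := Derives.subst (g' := g) (τ := .terminal) (φ := φ₂) (fun r hr =>
        Finset.mem_union_right _ (Finset.mem_union_right _ (Finset.mem_image_of_mem _ hr))) hw
      refine Produces.trans_derives
        ⟨⟨none, [.nonterminal (φ₂ g₂.initial)]⟩, by simp [g], .input_output⟩ ?_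
      simpa [substSymbol, Function.comp_def] using this

/-- The preimage of a context-free language under an injective renaming of letters: keep the rules
all of whose terminals are in the range of the renaming. -/
theorem comap {L : Language T} (hL : L.IsContextFree) {i : T' → T}
    (hi : Function.Injective i) : Language.IsContextFree {w : List T' | w.map i ∈ L} := by
  obtain ⟨g, rfl⟩ := hL
  let τ : T' → Symbol T g.NT := fun t => .terminal (i t)
  have hsym : Function.Injective (substSymbol τ (id : g.NT → g.NT)) := by
    rintro (a | a) (b | b) h
    · simpa [substSymbol, τ, hi.eq_iff] using h
    · cases h
    · cases h
    · simpa [substSymbol] using h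
  have hrule : Function.Injective (substRule τ (id : g.NT → g.NT)) := by
    rintro ⟨a, u⟩ ⟨b, v⟩ h
    simp only [substRule, id, ContextFreeRule.mk.injEq] at h
    rw [h.1, hsym.list_map h.2]
  let g' : ContextFreeGrammar T' :=
    ⟨g.NT, g.initial, g.rules.preimage (substRule τ id) hrule.injOn⟩
  have hterm (w : List T') : (w.map i).map Symbol.terminal =
      (w.map Symbol.terminal).map (substSymbol τ (id : g.NT → g.NT)) := by
    simp [substSymbol, τ]
  have lifts {x : List (Symbol T g.NT)} {w : List T'}
      (h : g.Derives x ((w.map i).map .terminal)) :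
      ∃ x', x = x'.map (substSymbol τ id) ∧ g'.Derives x' (w.map .terminal) := by
    induction h using Relation.ReflTransGen.head_induction_on with
    | refl => exact ⟨_, hterm w, .refl _⟩
    | head hp _ ih =>
      obtain ⟨y', rfl, hy'⟩ := ih
      obtain ⟨r, hr, hrw⟩ := hp
      obtain ⟨p, q, rfl, hy⟩ := hrw.exists_parts
      obtain ⟨pr, q, rfl, hpr, rfl⟩ := List.map_eq_append_iff.1 hy
      obtain ⟨p, o, rfl, rfl, ho⟩ := List.map_eq_append_iff.1 hpr
      refine ⟨p ++ [.nonterminal r.input] ++ q, by simp [substSymbol], ?_⟩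
      refine Produces.trans_derives ⟨⟨r.input, o⟩, ?_,
        ContextFreeRule.rewrites_of_exists_parts ⟨r.input, o⟩ p q⟩ hy'
      simpa [g', substRule, ho] using hr
  refine ⟨g', Set.Subset.antisymm (fun w hw => ?_) (fun w hw => ?_)⟩
  · have := Derives.subst (g := g') (g' := g) (τ := τ) (φ := id)
      (fun r hr => (Finset.mem_preimage (hf := hrule.injOn)).1 hr) hw
    rw [← hterm] at this
    exact this
  · obtain ⟨x, hx, hd⟩ := lifts hw
    obtain rfl : x = [.nonterminal g.initial] := hsym.list_map hx.symm
    exact hd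

end Language.IsContextFree

/-! ### Languages of pairs of words -/

section PairLanguage

variable {C : Type*}

/-- The language of all words `u # vʳᵉᵛ` with `R u v`. -/
def pairLanguage (R : List C → List C → Prop) : Language (Option C) :=
  {w | ∃ u v, R u v ∧ w = u.map some ++ none :: v.reverse.map some}

/-- The closure of a relation between words under componentwise concatenation. -/
inductive ConcatClosure (R : List C → List C → Prop) : List C → List C → Prop
  | single {u v} : R u v → ConcatClosure R u v
  | append {u v u' v'} : R u v → ConcatClosure R u' v' → ConcatClosure R (u ++ u') (v ++ v')

open ContextFreeGrammar in
/-- In a grammar for the pairs of `R`, the separator is made a nonterminal which produces either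
the separator or the initial symbol. -/
theorem pairLanguage_concatClosure_isContextFree {R : List C → List C → Prop}
    (hR : (pairLanguage R).IsContextFree) : (pairLanguage (ConcatClosure R)).IsContextFree := by
  classical
  obtain ⟨g, hg⟩ := hR
  let τ : Option C → Symbol (Option C) (Option g.NT) := fun t =>
    t.elim (.nonterminal none) fun c => .terminal (some c)
  let g' : ContextFreeGrammar (Option C) := ⟨Option g.NT, some g.initial,
    {⟨none, [.terminal none]⟩, ⟨none, [.nonterminal (some g.initial)]⟩} ∪
      g.rules.image (substRule τ some)⟩
  -- The language of the nonterminal that replaces the separator.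
  let K : Language (Option C) := {[none]} + pairLanguage (ConcatClosure R)
  let σ : Option C → Language (Option C) := fun t => t.elim K fun c => {[some c]}
  let I : Option g.NT → Language (Option C) := fun n => n.elim K (g.substLanguage σ)
  have hinit : g.substLanguage σ g.initial ≤ pairLanguage (ConcatClosure R) := by
    rintro w ⟨v, hv, hw⟩
    obtain ⟨x, y, hxy, rfl⟩ : v ∈ pairLanguage R := hg ▸ hv
    have hσ : σ ∘ some = fun c => {[some c]} := rfl
    simp only [List.map_append, List.map_cons, List.prod_append, List.prod_cons, List.map_map,
      hσ, prod_map_singleton] at hw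
    obtain ⟨_, rfl, b, hb, rfl⟩ := Language.mem_mul.1 hw
    obtain ⟨k, hk, _, rfl, rfl⟩ := Language.mem_mul.1 hb
    rcases hk with rfl | ⟨x', y', hxy', rfl⟩
    · exact ⟨x, y, .single hxy, by simp⟩
    · exact ⟨x ++ x', y ++ y', .append hxy hxy', by simp⟩
  have hK : pairLanguage (ConcatClosure R) ≤ K := fun _ hw => Or.inr hw
  refine ⟨g', Set.Subset.antisymm (fun w hw => ?_) ?_⟩
  · have key := Derives.mem_prod_symbolLanguage (g := g')
      (I := I) (fun r hr => by
        simp only [g', Finset.mem_union, Finset.mem_insert, Finset.mem_singleton,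
          Finset.mem_image] at hr
        rcases hr with (rfl | rfl) | ⟨r, hr, rfl⟩
        · simp [symbolLanguage, K, I]
        · simpa [symbolLanguage, I] using hinit.trans hK
        · exact prod_output_substRule_le (I := I) (σ := σ) (fun t => by cases t <;> rfl)
            (fun _ => rfl) hr) hw
    rw [List.map_singleton, List.prod_singleton] at key
    exact hinit key
  · rintro _ ⟨u, v, huv, rfl⟩
    have hder {u v : List C} (h : R u v) : g'.Derives [.nonterminal (some g.initial)]
        ((u.map fun c => .terminal (some c)) ++ [.nonterminal none] ++
          (v.reverse.map fun c => .terminal (some c))) := by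
      have hd : u.map some ++ none :: v.reverse.map some ∈ g.language := hg ▸ ⟨u, v, h, rfl⟩
      have := Derives.subst (g' := g') (τ := τ) (φ := some) (fun r hr =>
        Finset.mem_union_right _ (Finset.mem_image_of_mem _ hr)) hd
      simpa [substSymbol, Function.comp_def, τ] using this
    change g'.Derives [.nonterminal (some g.initial)] _
    induction huv with
    | @single u v h =>
      refine (hder h).trans_produces ⟨⟨none, [.terminal none]⟩, by simp [g'], ?_⟩
      simpa [Function.comp_def] using
        ContextFreeRule.rewrites_of_exists_parts (⟨none, [.terminal none]⟩ : ContextFreeRule _ _)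
          (u.map fun c => .terminal (some c)) (v.reverse.map fun c => .terminal (some c))
    | @append u v u' v' h _ ih =>
      have h₁ : g'.Derives [.nonterminal none] [.nonterminal (some g.initial)] :=
        Produces.single ⟨⟨none, [.nonterminal (some g.initial)]⟩, by simp [g'], .input_output⟩
      have := (hder h).trans (((h₁.trans ih).append_left _).append_right _)
      simpa [Function.comp_def] using this

end PairLanguage

/-! ### Evaluation of words and the word problem -/

namespace FreeSemigroup

theorem toWord_mul {A : Type*} (x y : FreeSemigroup A) :
    (x * y).toWord = x.toWord ++ y.toWord := rfl

theorem exists_toWord_eq {A : Type*} {u : List A} (hu : u ≠ []) :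
    ∃ x : FreeSemigroup A, x.toWord = u := by
  obtain ⟨a, u, rfl⟩ := List.exists_cons_of_ne_nil hu
  exact ⟨⟨a, u⟩, rfl⟩

end FreeSemigroup

section Eval

variable {A B S T : Type*} [Semigroup S] [Semigroup T]

/-- The value of a possibly empty word in `S` with an identity adjoined, where the letter `a`
stands for `f a`. -/
def wordEval (f : A → S) (u : List A) : WithOne S := (u.map fun a => (f a : WithOne S)).prod

@[simp] theorem wordEval_nil (f : A → S) : wordEval f [] = 1 := rfl

@[simp] theorem wordEval_cons (f : A → S) (a : A) (u : List A) :
    wordEval f (a :: u) = f a * wordEval f u := List.prod_cons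

@[simp] theorem wordEval_append (f : A → S) (u v : List A) :
    wordEval f (u ++ v) = wordEval f u * wordEval f v := by simp [wordEval]

theorem wordEval_toWord (f : A → S) (x : FreeSemigroup A) :
    wordEval f x.toWord = (FreeSemigroup.lift f x : S) := by
  induction x using FreeSemigroup.recOnMul with
  | ih1 a => exact mul_one _
  | ih2 a y iha ih =>
    rw [FreeSemigroup.toWord_mul, wordEval_append, iha, ih, map_mul, WithOne.coe_mul]

theorem exists_wordEval_eq_coe (f : A → S) {u : List A} (hu : u ≠ []) :
    ∃ s : S, wordEval f u = s := by
  obtain ⟨x, rfl⟩ := FreeSemigroup.exists_toWord_eq hu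
  exact ⟨_, wordEval_toWord f x⟩

theorem wordEval_eq_one_iff (f : A → S) {u : List A} : wordEval f u = 1 ↔ u = [] := by
  refine ⟨fun h => ?_, fun h => h ▸ rfl⟩
  by_contra hu
  obtain ⟨s, hs⟩ := exists_wordEval_eq_coe f hu
  exact WithOne.coe_ne_one (hs.symm.trans h)

theorem wordEval_map (ι : S →ₙ* T) {f : A → S} {f' : B → T} {j : A → B}
    (h : ∀ a, ι (f a) = f' (j a)) (u : List A) :
    wordEval f' (u.map j) = WithOne.mapMulHom ι (wordEval f u) := by
  induction u with
  | nil => simp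
  | cons a u ih => simp [ih, ← h]

theorem wordEval_map_eq_iff {ι : S →ₙ* T} (hι : Function.Injective ι) {f : A → S} {f' : B → T}
    {j : A → B} (h : ∀ a, ι (f a) = f' (j a)) {u v : List A} :
    wordEval f' (u.map j) = wordEval f' (v.map j) ↔ wordEval f u = wordEval f v := by
  rw [wordEval_map ι h, wordEval_map ι h]
  exact (WithOne.mapMulHom_injective hι).eq_iff

theorem semigroupWordProblem_eq_pairLanguage (f : A → S) :
    semigroupWordProblem f = pairLanguage fun u v => u ≠ [] ∧ wordEval f u = wordEval f v := by
  refine Set.Subset.antisymm ?_ ?_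
  · rintro _ ⟨x, y, hxy, rfl⟩
    refine ⟨x.toWord, y.toWord, ⟨List.cons_ne_nil _ _, ?_⟩, by simp⟩
    rw [wordEval_toWord, wordEval_toWord, hxy]
  · rintro _ ⟨u, v, ⟨hu, huv⟩, rfl⟩
    have hv : v ≠ [] := fun hv => hu <| (wordEval_eq_one_iff f).1 (by simp [huv, hv])
    obtain ⟨x, rfl⟩ := FreeSemigroup.exists_toWord_eq hu
    obtain ⟨y, rfl⟩ := FreeSemigroup.exists_toWord_eq hv
    rw [wordEval_toWord, wordEval_toWord, WithOne.coe_inj] at huv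
    exact ⟨x, y, huv, by simp⟩

/-- The word problem of a subsemigroup, with respect to generators taken from those of the whole
semigroup, is the part of the word problem of the latter that uses only these letters. -/
theorem semigroupWordProblem_eq_comap {ι : S →ₙ* T} (hι : Function.Injective ι) {f : A → S}
    {f' : B → T} {j : A → B} (h : ∀ a, ι (f a) = f' (j a)) :
    semigroupWordProblem f = {w | w.map (Option.map j) ∈ semigroupWordProblem f'} := by
  rw [semigroupWordProblem_eq_pairLanguage, semigroupWordProblem_eq_pairLanguage]
  refine Set.Subset.antisymm ?_ fun w hw => ?_
  · rintro _ ⟨u, v, ⟨hu, huv⟩, rfl⟩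
    exact ⟨u.map j, v.map j, ⟨by simpa using hu, (wordEval_map_eq_iff hι h).2 huv⟩,
      by simp [Function.comp_def]⟩
  · have lifts {x : List (Option A)} {y : List B}
        (hxy : x.map (Option.map j) = y.map some) : ∃ z : List A, x = z.map some ∧ y = z.map j := by
      induction x generalizing y with
      | nil => exact ⟨[], rfl, by simpa using hxy.symm⟩
      | cons a x ih =>
        cases y with
        | nil => simp at hxy
        | cons b y =>
          simp only [List.map_cons, List.cons.injEq, Option.map_eq_some_iff] at hxy
          obtain ⟨⟨a, rfl, rfl⟩, hxy⟩ := hxy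
          obtain ⟨z, rfl, rfl⟩ := ih hxy
          exact ⟨a :: z, rfl, rfl⟩
    obtain ⟨u, v, ⟨hu, huv⟩, hw⟩ := hw
    obtain ⟨x, y, rfl, hx, hy⟩ := List.map_eq_append_iff.1 hw
    obtain ⟨o, y, rfl, ho, hy'⟩ := List.map_eq_cons_iff.1 hy
    obtain rfl := Option.map_eq_none_iff.1 ho
    obtain ⟨u, rfl, rfl⟩ := lifts hx
    obtain ⟨z, rfl, hv⟩ := lifts hy'
    obtain rfl : v = z.reverse.map j := by rw [List.map_reverse, ← hv, List.reverse_reverse]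
    exact ⟨u, z.reverse, ⟨by simpa using hu, (wordEval_map_eq_iff hι h).1 huv⟩, by simp⟩

/-- A context-free word problem may be given with respect to any injective finite family of
generators. -/
theorem HasContextFreeWordProblem.of_injective [Finite A] {f : A → S}
    (hf : Function.Injective f) (hgen : Subsemigroup.closure (Set.range f) = ⊤)
    (hwp : (semigroupWordProblem f).IsContextFree) : HasContextFreeWordProblem S := by
  refine ⟨Set.range f, Set.finite_range f, hgen, ?_⟩
  rw [semigroupWordProblem_eq_comap (ι := MulHom.id S) Function.injective_id (f' := f)
    (j := (Equiv.ofInjective f hf).symm) fun x => (Equiv.apply_ofInjective_symm hf x).symm]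
  exact hwp.comap (Option.map_injective (Equiv.injective _))

/-- A context-free word problem is inherited by a subsemigroup whose complement is an ideal: a
product of generators lies in the subsemigroup only if each generator does, so the generators
lying in the subsemigroup generate it. -/
theorem HasContextFreeWordProblem.of_mulHom {ι : S →ₙ* T} (hι : Function.Injective ι)
    (hmul : ∀ x y, x * y ∈ Set.range ι → x ∈ Set.range ι ∧ y ∈ Set.range ι)
    (hT : HasContextFreeWordProblem T) : HasContextFreeWordProblem S := by
  obtain ⟨X, hX, hgen, hwp⟩ := hT
  refine ⟨ι ⁻¹' X, hX.preimage hι.injOn, ?_, ?_⟩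
  · have key (t : T) (ht : t ∈ Subsemigroup.closure X) :
        ∀ s, ι s = t → s ∈ Subsemigroup.closure (ι ⁻¹' X) := by
      induction ht using Subsemigroup.closure_induction with
      | mem t ht => rintro s rfl; exact Subsemigroup.subset_closure ht
      | mul x y _ _ ihx ihy =>
        intro s hs
        obtain ⟨⟨a, rfl⟩, b, rfl⟩ := hmul x y ⟨s, hs⟩
        rw [← map_mul] at hs
        rw [hι hs]
        exact mul_mem (ihx a rfl) (ihy b rfl)
    exact eq_top_iff.2 fun s _ => key (ι s) (hgen ▸ Subsemigroup.mem_top _) s rfl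
  · let j : ↥(ι ⁻¹' X) → X := fun s => ⟨ι s, s.2⟩
    have hj : Function.Injective j := fun a b h => Subtype.ext (hι (congrArg Subtype.val h))
    rw [semigroupWordProblem_eq_comap hι (f' := (Subtype.val : X → T)) (j := j) fun _ => rfl]
    exact hwp.comap (Option.map_injective hj)

end Eval

/-! ### Free products and normal forms -/

namespace SemigroupFreeProduct

variable {S T M : Type*} [Semigroup S] [Semigroup T] [Semigroup M]

/-- The inclusion of the left factor. -/
def inl : S →ₙ* SemigroupFreeProduct S T where
  toFun s := ((FreeSemigroup.of (.inl s) : FreeSemigroup (S ⊕ T)) : SemigroupFreeProduct S T)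
  map_mul' x y := ((Con.eq _).2 (ConGen.Rel.of _ _ (.inl x y))).symm

/-- The inclusion of the right factor. -/
def inr : T →ₙ* SemigroupFreeProduct S T where
  toFun t := ((FreeSemigroup.of (.inr t) : FreeSemigroup (S ⊕ T)) : SemigroupFreeProduct S T)
  map_mul' x y := ((Con.eq _).2 (ConGen.Rel.of _ _ (.inr x y))).symm

/-- The homomorphism out of the free product that is given by `f` and `h` on the factors. -/
def lift (f : S →ₙ* M) (h : T →ₙ* M) : SemigroupFreeProduct S T →ₙ* M where
  toFun x := Con.liftOn x (FreeSemigroup.lift (Sum.elim f h)) fun a b hab => by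
    have hle : conGen (Rel S T) ≤ Con.ker (FreeSemigroup.lift (Sum.elim f h)) := by
      refine Con.conGen_le.2 fun _ _ hr => ?_
      cases hr <;> simp [Con.ker_rel]
    exact hle hab
  map_mul' x y := by
    induction x, y using Con.induction_on₂ with
    | _ x y => exact map_mul (FreeSemigroup.lift (Sum.elim f h)) x y

@[elab_as_elim]
theorem induction_on {p : SemigroupFreeProduct S T → Prop} (x : SemigroupFreeProduct S T)
    (hl : ∀ s, p (inl s)) (hr : ∀ t, p (inr t)) (hmul : ∀ x y, p x → p y → p (x * y)) : p x := by
  induction x using Con.induction_on with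
  | _ x =>
    have hof (a : S ⊕ T) : p (FreeSemigroup.of a : FreeSemigroup (S ⊕ T)) := by
      cases a with
      | inl s => exact hl s
      | inr t => exact hr t
    induction x using FreeSemigroup.recOnMul with
    | ih1 a => exact hof a
    | ih2 a y _ ih => exact hmul _ _ (hof a) ih

theorem closure_image_union_image (s : Set S) (t : Set T)
    (hs : Subsemigroup.closure s = ⊤) (ht : Subsemigroup.closure t = ⊤) :
    Subsemigroup.closure (inl '' s ∪ inr '' t : Set (SemigroupFreeProduct S T)) = ⊤ := by
  refine eq_top_iff.2 fun x _ => ?_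
  induction x using induction_on with
  | hl a =>
    have : inl a ∈ (Subsemigroup.closure s).map (inl : S →ₙ* SemigroupFreeProduct S T) :=
      ⟨a, by simp [hs], rfl⟩
    rw [MulHom.map_mclosure] at this
    exact Subsemigroup.closure_mono Set.subset_union_left this
  | hr a =>
    have : inr a ∈ (Subsemigroup.closure t).map (inr : T →ₙ* SemigroupFreeProduct S T) :=
      ⟨a, by simp [ht], rfl⟩
    rw [MulHom.map_mclosure] at this
    exact Subsemigroup.closure_mono Set.subset_union_right this
  | hmul x y hx hy => exact mul_mem (hx trivial) (hy trivial)

/-- The homomorphism that is the identity on `S` and maps all other elements to zero. -/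
def toWithZeroLeft : SemigroupFreeProduct S T →ₙ* WithZero S :=
  lift ⟨fun s => (s : WithZero S), fun _ _ => WithZero.coe_mul _ _⟩ ⟨fun _ => 0, by simp⟩

/-- The homomorphism that is the identity on `T` and maps all other elements to zero. -/
def toWithZeroRight : SemigroupFreeProduct S T →ₙ* WithZero T :=
  lift ⟨fun _ => 0, by simp⟩ ⟨fun t => (t : WithZero T), fun _ _ => WithZero.coe_mul _ _⟩

theorem inl_injective : Function.Injective (inl : S →ₙ* SemigroupFreeProduct S T) :=
  fun a b h => WithZero.coe_inj.1 (congrArg toWithZeroLeft h : (a : WithZero S) = b)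

theorem inr_injective : Function.Injective (inr : T →ₙ* SemigroupFreeProduct S T) :=
  fun a b h => WithZero.coe_inj.1 (congrArg toWithZeroRight h : (a : WithZero T) = b)

theorem inl_ne_inr (s : S) (t : T) : (inl s : SemigroupFreeProduct S T) ≠ inr t :=
  fun h => WithZero.coe_ne_zero (congrArg toWithZeroLeft h : (s : WithZero S) = 0)

theorem mem_range_inl {x : SemigroupFreeProduct S T} (hx : toWithZeroLeft x ≠ 0) :
    x ∈ Set.range (inl : S →ₙ* SemigroupFreeProduct S T) := by
  induction x using induction_on with
  | hl s => exact ⟨s, rfl⟩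
  | hr t => exact absurd rfl hx
  | hmul x y ihx ihy =>
    rw [map_mul] at hx
    obtain ⟨a, rfl⟩ := ihx (left_ne_zero_of_mul hx)
    obtain ⟨b, rfl⟩ := ihy (right_ne_zero_of_mul hx)
    exact ⟨a * b, map_mul _ _ _⟩

theorem mem_range_inr {x : SemigroupFreeProduct S T} (hx : toWithZeroRight x ≠ 0) :
    x ∈ Set.range (inr : T →ₙ* SemigroupFreeProduct S T) := by
  induction x using induction_on with
  | hl s => exact absurd rfl hx
  | hr t => exact ⟨t, rfl⟩
  | hmul x y ihx ihy =>
    rw [map_mul] at hx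
    obtain ⟨a, rfl⟩ := ihx (left_ne_zero_of_mul hx)
    obtain ⟨b, rfl⟩ := ihy (right_ne_zero_of_mul hx)
    exact ⟨a * b, map_mul _ _ _⟩

/-- The elements outside the left factor form an ideal. -/
theorem mem_range_inl_of_mul {x y : SemigroupFreeProduct S T}
    (h : x * y ∈ Set.range (inl : S →ₙ* SemigroupFreeProduct S T)) :
    x ∈ Set.range (inl : S →ₙ* SemigroupFreeProduct S T) ∧
      y ∈ Set.range (inl : S →ₙ* SemigroupFreeProduct S T) := by
  obtain ⟨s, hs⟩ := h
  have h0 : toWithZeroLeft x * toWithZeroLeft y ≠ 0 := by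
    rw [← map_mul, ← hs]
    exact WithZero.coe_ne_zero
  exact ⟨mem_range_inl (left_ne_zero_of_mul h0), mem_range_inl (right_ne_zero_of_mul h0)⟩

/-- The elements outside the right factor form an ideal. -/
theorem mem_range_inr_of_mul {x y : SemigroupFreeProduct S T}
    (h : x * y ∈ Set.range (inr : T →ₙ* SemigroupFreeProduct S T)) :
    x ∈ Set.range (inr : T →ₙ* SemigroupFreeProduct S T) ∧
      y ∈ Set.range (inr : T →ₙ* SemigroupFreeProduct S T) := by
  obtain ⟨t, ht⟩ := h
  have h0 : toWithZeroRight x * toWithZeroRight y ≠ 0 := by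
    rw [← map_mul, ← ht]
    exact WithZero.coe_ne_zero
  exact ⟨mem_range_inr (left_ne_zero_of_mul h0), mem_range_inr (right_ne_zero_of_mul h0)⟩

/-- Left multiplication of a normal form, a list of elements taken alternately from the two
factors, by an element of a factor. -/
def consMul : S ⊕ T → List (S ⊕ T) → List (S ⊕ T)
  | .inl s, .inl s' :: l => .inl (s * s') :: l
  | .inr t, .inr t' :: l => .inr (t * t') :: l
  | x, l => x :: l

theorem consMul_ne_nil (x : S ⊕ T) (l : List (S ⊕ T)) : consMul x l ≠ [] := by
  rcases x with s | t <;> rcases l with _ | ⟨s | t, l⟩ <;> exact List.cons_ne_nil _ _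

/-- The action of the free product on normal forms by left multiplication. It is defined on all
lists, alternating or not. -/
def action : SemigroupFreeProduct S T →ₙ* Function.End (List (S ⊕ T)) :=
  lift
    { toFun := fun s => consMul (.inl s)
      map_mul' := fun x y => by
        funext l
        change consMul (.inl (x * y)) l = consMul (.inl x) (consMul (.inl y) l)
        rcases l with _ | ⟨a | a, l⟩ <;> simp [consMul, mul_assoc] }
    { toFun := fun t => consMul (.inr t)
      map_mul' := fun x y => by
        funext l
        change consMul (.inr (x * y)) l = consMul (.inr x) (consMul (.inr y) l)
        rcases l with _ | ⟨a | a, l⟩ <;> simp [consMul, mul_assoc] }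

variable {A B : Type*}

/-- The generators of the free product given by generators of the two factors. -/
def generators (f : A → S) (h : B → T) : A ⊕ B → SemigroupFreeProduct S T :=
  Sum.elim (fun a => inl (f a)) fun b => inr (h b)

/-- The normal form of the element represented by a word in the generators of the factors. -/
def normalForm (f : A → S) (h : B → T) (w : List (A ⊕ B)) : List (S ⊕ T) :=
  w.foldr (fun c l => consMul (Sum.map f h c) l) []

theorem normalForm_eq_action (f : A → S) (h : B → T) (w : List (A ⊕ B)) :
    normalForm f h w = WithOne.lift action (wordEval (generators f h) w) [] := by
  induction w with
  | nil => simp [normalForm, Function.End.one_def]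
  | cons c w ih =>
    have : normalForm f h (c :: w) = consMul (Sum.map f h c) (normalForm f h w) := rfl
    rw [this, ih, wordEval_cons, map_mul, Function.End.mul_def, WithOne.lift_coe]
    cases c <;> rfl

/-- The word `w` is written in the generators of one factor and represents its element `x`. -/
def IsBlock (f : A → S) (h : B → T) (w : List (A ⊕ B)) : S ⊕ T → Prop
  | .inl s => ∃ u : List A, w = u.map .inl ∧ wordEval f u = s
  | .inr t => ∃ u : List B, w = u.map .inr ∧ wordEval h u = t

/-- The entries of the normal form are represented by consecutive blocks of the word. -/
theorem exists_isBlock (f : A → S) (h : B → T) {w : List (A ⊕ B)} {x : S ⊕ T}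
    {l : List (S ⊕ T)} (hw : normalForm f h w = x :: l) :
    ∃ w₁ w₂, w = w₁ ++ w₂ ∧ IsBlock f h w₁ x ∧ normalForm f h w₂ = l := by
  induction w generalizing x l with
  | nil => cases hw
  | cons c w ih =>
    have hc : IsBlock f h [c] (Sum.map f h c) := by
      cases c with
      | inl a => exact ⟨[a], rfl, by simp⟩
      | inr b => exact ⟨[b], rfl, by simp⟩
    replace hw : consMul (Sum.map f h c) (normalForm f h w) = x :: l := hw
    rcases hn : normalForm f h w with _ | ⟨y, l'⟩
    · rw [hn] at hw
      have : [Sum.map f h c] = x :: l := by cases c <;> exact hw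
      obtain ⟨rfl, rfl⟩ := List.cons.inj this
      exact ⟨[c], w, rfl, hc, hn⟩
    · rw [hn] at hw
      obtain ⟨w₁, w₂, rfl, hb, hn₂⟩ := ih hn
      rcases c with a | b <;> rcases y with s | t
      · obtain ⟨rfl, rfl⟩ := List.cons.inj hw
        obtain ⟨u, rfl, hu⟩ := hb
        exact ⟨_, w₂, rfl, ⟨a :: u, rfl, by simp [hu]⟩, hn₂⟩
      · obtain ⟨rfl, rfl⟩ := List.cons.inj hw
        exact ⟨[.inl a], _, rfl, hc, hn⟩
      · obtain ⟨rfl, rfl⟩ := List.cons.inj hw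
        exact ⟨[.inr b], _, rfl, hc, hn⟩
      · obtain ⟨rfl, rfl⟩ := List.cons.inj hw
        obtain ⟨u, rfl, hu⟩ := hb
        exact ⟨_, w₂, rfl, ⟨b :: u, rfl, by simp [hu]⟩, hn₂⟩

/-- Two nonempty words in the generators of the same factor with equal values there. -/
def BlockRel (f : A → S) (h : B → T) (u v : List (A ⊕ B)) : Prop :=
  (∃ u' v', (u' ≠ [] ∧ wordEval f u' = wordEval f v') ∧ u = u'.map .inl ∧ v = v'.map .inl) ∨
    ∃ u' v', (u' ≠ [] ∧ wordEval h u' = wordEval h v') ∧ u = u'.map .inr ∧ v = v'.map .inr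

theorem IsBlock.blockRel {f : A → S} {h : B → T} {u v : List (A ⊕ B)} {x : S ⊕ T}
    (hu : IsBlock f h u x) (hv : IsBlock f h v x) : BlockRel f h u v := by
  cases x with
  | inl s =>
    obtain ⟨u, rfl, hu⟩ := hu
    obtain ⟨v, rfl, hv⟩ := hv
    exact .inl ⟨u, v, ⟨by rintro rfl; exact WithOne.coe_ne_one hu.symm, hu.trans hv.symm⟩, rfl, rfl⟩
  | inr t =>
    obtain ⟨u, rfl, hu⟩ := hu
    obtain ⟨v, rfl, hv⟩ := hv
    exact .inr ⟨u, v, ⟨by rintro rfl; exact WithOne.coe_ne_one hu.symm, hu.trans hv.symm⟩, rfl, rfl⟩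

theorem BlockRel.ne_nil_and_eq {f : A → S} {h : B → T} {u v : List (A ⊕ B)}
    (huv : BlockRel f h u v) :
    u ≠ [] ∧ wordEval (generators f h) u = wordEval (generators f h) v := by
  rcases huv with ⟨u, v, ⟨hu, huv⟩, rfl, rfl⟩ | ⟨u, v, ⟨hu, huv⟩, rfl, rfl⟩
  · exact ⟨by simpa using hu,
      (wordEval_map_eq_iff (f' := generators f h) inl_injective fun _ => rfl).2 huv⟩
  · exact ⟨by simpa using hu,
      (wordEval_map_eq_iff (f' := generators f h) inr_injective fun _ => rfl).2 huv⟩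

theorem normalForm_eq_nil_iff {f : A → S} {h : B → T} {w : List (A ⊕ B)} :
    normalForm f h w = [] ↔ w = [] := by
  refine ⟨fun hw => ?_, fun hw => hw ▸ rfl⟩
  cases w with
  | nil => rfl
  | cons c w => exact absurd hw (consMul_ne_nil _ _)

theorem concatClosure_blockRel_of_normalForm_eq {f : A → S} {h : B → T} {u v : List (A ⊕ B)}
    (hu : u ≠ []) (huv : normalForm f h u = normalForm f h v) :
    ConcatClosure (BlockRel f h) u v := by
  generalize hl : normalForm f h v = l at huv
  induction l generalizing u v with
  | nil => exact absurd (normalForm_eq_nil_iff.1 huv) hu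
  | cons x l ih =>
    obtain ⟨u₁, u₂, rfl, hbu, hu₂⟩ := exists_isBlock f h huv
    obtain ⟨v₁, v₂, rfl, hbv, hv₂⟩ := exists_isBlock f h hl
    have hb := hbu.blockRel hbv
    by_cases hu0 : u₂ = []
    · obtain rfl : v₂ = [] := by
        rw [← normalForm_eq_nil_iff (f := f) (h := h), hv₂, ← hu₂, hu0]
        rfl
      simpa [hu0] using ConcatClosure.single hb
    · exact .append hb (ih hu0 hv₂ hu₂)

/-- Equality of words in the free product is generated by equality of words in the factors. -/
theorem concatClosure_blockRel_iff {f : A → S} {h : B → T} {u v : List (A ⊕ B)} :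
    ConcatClosure (BlockRel f h) u v ↔
      u ≠ [] ∧ wordEval (generators f h) u = wordEval (generators f h) v := by
  constructor
  · intro huv
    induction huv with
    | single huv => exact huv.ne_nil_and_eq
    | append huv _ ih => simp [huv.ne_nil_and_eq.1, huv.ne_nil_and_eq.2, ih.2]
  · rintro ⟨hu, huv⟩
    exact concatClosure_blockRel_of_normalForm_eq hu
      (by rw [normalForm_eq_action, normalForm_eq_action, huv])

theorem pairLanguage_blockRel (f : A → S) (h : B → T) :
    pairLanguage (BlockRel f h) = Language.map (Option.map .inl) (semigroupWordProblem f) +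
      Language.map (Option.map .inr) (semigroupWordProblem h) := by
  rw [semigroupWordProblem_eq_pairLanguage, semigroupWordProblem_eq_pairLanguage]
  refine Set.Subset.antisymm ?_ ?_
  · rintro _ ⟨_, _, ⟨u, v, huv, rfl, rfl⟩ | ⟨u, v, huv, rfl, rfl⟩, rfl⟩
    · exact .inl ⟨_, ⟨u, v, huv, rfl⟩, by simp [Function.comp_def]⟩
    · exact .inr ⟨_, ⟨u, v, huv, rfl⟩, by simp [Function.comp_def]⟩
  · rintro _ (⟨_, ⟨u, v, huv, rfl⟩, rfl⟩ | ⟨_, ⟨u, v, huv, rfl⟩, rfl⟩)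
    · exact ⟨_, _, .inl ⟨u, v, huv, rfl, rfl⟩, by simp [Function.comp_def]⟩
    · exact ⟨_, _, .inr ⟨u, v, huv, rfl, rfl⟩, by simp [Function.comp_def]⟩

theorem generators_injective {f : A → S} {h : B → T} (hf : Function.Injective f)
    (hh : Function.Injective h) : Function.Injective (generators f h) :=
  Function.Injective.sumElim (inl_injective.comp hf) (inr_injective.comp hh)
    fun _ _ => inl_ne_inr _ _

theorem hasContextFreeWordProblem (hS : HasContextFreeWordProblem S)
    (hT : HasContextFreeWordProblem T) :
    HasContextFreeWordProblem (SemigroupFreeProduct S T) := by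
  obtain ⟨X, hX, hgX, hwX⟩ := hS
  obtain ⟨Y, hY, hgY, hwY⟩ := hT
  have := hX.to_subtype
  have := hY.to_subtype
  refine .of_injective (f := generators (Subtype.val : X → S) (Subtype.val : Y → T))
    (generators_injective Subtype.val_injective Subtype.val_injective) ?_ ?_
  · rw [← closure_image_union_image X Y hgX hgY, generators, Set.Sum.elim_range]
    simp only [Set.image_eq_range]
  · rw [semigroupWordProblem_eq_pairLanguage]
    simp_rw [← concatClosure_blockRel_iff]
    refine pairLanguage_concatClosure_isContextFree ?_
    rw [pairLanguage_blockRel]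
    exact (hwX.map _).add (hwY.map _)

end SemigroupFreeProduct

theorem mainTheorem3 {S : Type*} {T : Type*} {U : Type*} [Semigroup S] [Semigroup T] [Semigroup U]
    (e : U ≃* SemigroupFreeProduct S T) :
    (HasContextFreeWordProblem S → HasContextFreeWordProblem T → HasContextFreeWordProblem U) ∧
      (HasContextFreeWordProblem U →
        HasContextFreeWordProblem S ∧ HasContextFreeWordProblem T) := by
  refine ⟨fun hS hT => ?_, fun hU => ?_⟩
  · exact .of_mulHom (ι := (e : U →ₙ* SemigroupFreeProduct S T)) e.injective
      (fun x y _ => ⟨e.surjective x, e.surjective y⟩)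
      (SemigroupFreeProduct.hasContextFreeWordProblem hS hT)
  · have hP : HasContextFreeWordProblem (SemigroupFreeProduct S T) :=
      .of_mulHom (ι := (e.symm : SemigroupFreeProduct S T →ₙ* U)) e.symm.injective
        (fun x y _ => ⟨e.symm.surjective x, e.symm.surjective y⟩) hU
    exact ⟨.of_mulHom SemigroupFreeProduct.inl_injective
        (fun _ _ => SemigroupFreeProduct.mem_range_inl_of_mul) hP,
      .of_mulHom SemigroupFreeProduct.inr_injective
        (fun _ _ => SemigroupFreeProduct.mem_range_inr_of_mul) hP⟩
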